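/- Let $k$ be a local field (a locally compact, non-discrete topological field) of characteristic $p>0$. Let $X$ and $Y$ be second countable analytic manifolds over $k$ of dimensions $m$ and $r$ respectively, and let $f\colon X\to Y$ be an analytic map. Let $$C=\{x\in X : df_x\colon T_xX\to T_{f(x)}Y \text{ is not surjective}\}$$ be the critical set of $f$. If $p>m-r+1$, then $f(C)$ has measure zero in $Y$; that is, for every analytic chart $\varphi\colon U\to k^r$ of $Y$ the set $\varphi(f(C)\cap U)$ is a null set for Haar measure on $k^r$. -/

import Mathlib

open scoped Manifold ContDiff

/-- The critical set of a map `f : X → Y` of analytic manifolds over `k` of dimensions `m` and `r`: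
the points at which the differential `T_x X → T_{f x} Y` is not surjective. Equivalently, the
differentials at `x` of the `r` components of `f` in local coordinates are linearly dependent. -/
def criticalSet (k : Type*) [NontriviallyNormedField k] (m r : ℕ)
    {X : Type*} [TopologicalSpace X] [ChartedSpace (Fin m → k) X]
    {Y : Type*} [TopologicalSpace Y] [ChartedSpace (Fin r → k) Y]
    (f : X → Y) : Set X :=
  {x | ¬ Function.Surjective (mfderiv 𝓘(k, Fin m → k) 𝓘(k, Fin r → k) f x)}

/-- A subset `S` of an `r`-dimensional analytic manifold `Y` over `k` has measure zero if its image
in `k ^ r` under every analytic chart of `Y` is null for (every) Haar measure of `k ^ r`. -/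
def HasMeasureZero (k : Type*) [NontriviallyNormedField k] [MeasurableSpace k] (r : ℕ)
    {Y : Type*} [TopologicalSpace Y] [ChartedSpace (Fin r → k) Y] (S : Set Y) : Prop :=
  ∀ e ∈ IsManifold.maximalAtlas 𝓘(k, Fin r → k) ω Y,
    ∀ μ : MeasureTheory.Measure (Fin r → k), μ.IsAddHaarMeasure → μ (e '' (S ∩ e.source)) = 0

open MeasureTheory Set Filter Topology Metric Asymptotics
open Module (finrank)
open scoped ENNReal NNReal Pointwise

/-!
The key is a covering argument. If `f y - f x = O(‖y - x‖ ^ d)` at every point `x` of a subset `S`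
of an `n`-dimensional space, then `f '' S` is null in dimension `r` as soon as `n < d * r`. Indeed,
let `u` be a scalar with `‖u‖ < 1` and let `δ < 1` be its modulus: a bounded part of `S` is covered
by `O(δ ^ (-n * j))` balls of radius `‖u‖ ^ j`, whose images have measure `O(δ ^ (d * r * j))`.

The critical points of an analytic map `f` from dimension `n` to dimension `r` are split into three
parts, by induction on `n`.
* Where `df ≠ 0`, some component of `f` can be taken as a coordinate, and Fubini reduces to maps
  from dimension `n - 1` to dimension `r - 1`.
* Where `df = 0` and some derivative of order `i` vanishes but the next one does not, the points lie
  locally on an analytic hypersurface, and they are critical for the restriction of `f` to it: this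
  reduces to dimension `n - 1` with the same `r`.
* Where the derivatives of orders `1, …, d` vanish, so do the Taylor coefficients of these orders
  provided that `d ! ≠ 0` in `k`, because `i ! • c` is a value of the `i`-th derivative if `c` is a
  value of the coefficient of degree `i`. The covering argument applies with exponent `d + 1`.
-/

section HaarMeasure

variable {k : Type*} [NontriviallyNormedField k] [ProperSpace k]

theorem distribHaarChar_lt_one_of_norm_lt_one {u : kˣ} (hu : ‖(u : k)‖ < 1) :
    distribHaarChar k u < 1 := by
  borelize k
  let μ : Measure k := Measure.addHaar
  have hfin (n : ℕ) : μ (closedBall 0 (‖(u : k)‖ ^ n)) ≠ ⊤ := measure_closedBall_lt_top.ne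
  have hscale (n : ℕ) : μ (closedBall 0 (‖(u : k)‖ ^ (n + 1))) =
      distribHaarChar k u * μ (closedBall 0 (‖(u : k)‖ ^ n)) := by
    rw [distribHaarChar_mul, Units.smul_def, _root_.smul_closedBall _ _ (by positivity),
      smul_zero, pow_succ']
  have hlim : Tendsto (fun n : ℕ => μ (closedBall 0 (‖(u : k)‖ ^ n))) atTop (𝓝 0) := by
    have hinter : ⋂ n : ℕ, closedBall (0 : k) (‖(u : k)‖ ^ n) = {0} := by
      refine Subset.antisymm (fun x hx => ?_) (by simp)
      have hle : ‖x‖ ≤ 0 :=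
        ge_of_tendsto' (tendsto_pow_atTop_nhds_zero_of_lt_one (norm_nonneg _) hu)
          fun n => mem_closedBall_zero_iff.1 (mem_iInter.1 hx n)
      exact norm_le_zero_iff.1 hle
    have := tendsto_measure_iInter_atTop (μ := μ)
      (fun n => (isClosed_closedBall (x := (0 : k)) (ε := ‖(u : k)‖ ^ n)).nullMeasurableSet)
      (fun i j hij => closedBall_subset_closedBall (pow_le_pow_of_le_one (norm_nonneg _) hu.le hij))
      ⟨0, hfin 0⟩
    rwa [hinter, measure_singleton] at this
  by_contra! h
  have hmono : Monotone fun n : ℕ => μ (closedBall 0 (‖(u : k)‖ ^ n)) :=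
    monotone_nat_of_le_succ fun n => by
      rw [hscale]
      exact le_mul_of_one_le_left' (by exact_mod_cast h)
  have hpos : 0 < μ (closedBall 0 (‖(u : k)‖ ^ 0)) := measure_closedBall_pos μ 0 (by simp)
  exact hpos.not_ge (ge_of_tendsto' hlim fun n => hmono n.zero_le)

variable {E : Type*} [NormedAddCommGroup E] [NormedSpace k E] [FiniteDimensional k E]

theorem distribHaarChar_pi (n : ℕ) (u : kˣ) :
    distribHaarChar (Fin n → k) u = distribHaarChar k u ^ n := by
  borelize k
  let μ : Measure k := Measure.addHaar
  let B : Set (Fin n → k) := univ.pi fun _ => closedBall 0 1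
  have hB : Measure.pi (fun _ : Fin n => μ) B = μ (closedBall 0 1) ^ n := by
    simp [B, Measure.pi_pi]
  have hsB : u • B = univ.pi fun _ => u • closedBall (0 : k) 1 := smul_univ_pi ..
  refine distribHaarChar_eq_of_measure_smul_eq_mul (μ := Measure.pi fun _ => μ) (s := B) ?_ ?_ ?_
  · rw [hB]
    exact pow_ne_zero _ (measure_closedBall_pos μ 0 one_pos).ne'
  · rw [hB]
    exact ENNReal.pow_ne_top measure_closedBall_lt_top.ne
  · rw [hsB, hB, Measure.pi_pi, ← distribHaarChar_mul, Finset.prod_const, Finset.card_fin,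
      mul_pow, ENNReal.coe_pow]

theorem measure_units_smul_set [MeasurableSpace E] [BorelSpace E]
    (μ : Measure E) [μ.IsAddHaarMeasure] (u : kˣ) (s : Set E) :
    μ (u • s) = distribHaarChar k u ^ finrank k E * μ s := by
  borelize k
  have := FiniteDimensional.proper k E
  let e : E ≃L[k] (Fin (finrank k E) → k) := ContinuousLinearEquiv.ofFinrankEq (by simp)
  have := e.isAddHaarMeasure_map μ
  have hmap (t : Set E) : μ t = μ.map e (e '' t) :=
    (congrArg μ (preimage_image_eq t e.injective)).symm.trans
      (e.toHomeomorph.toMeasurableEquiv.map_apply _).symm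
  have hsmul : e '' (u • s) = u • e '' s := image_smul_comm e u s fun x => by
    simp only [Units.smul_def, map_smul]
  rw [hmap, hsmul, ← distribHaarChar_mul (μ.map e), distribHaarChar_pi, hmap s, ENNReal.coe_pow]

theorem measure_closedBall_norm_pow_mul [MeasurableSpace E] [BorelSpace E]
    (μ : Measure E) [μ.IsAddHaarMeasure] (u : kˣ) (x : E)
    {R : ℝ} (hR : 0 ≤ R) (n : ℕ) :
    μ (closedBall x (‖(u : k)‖ ^ n * R)) =
      distribHaarChar k u ^ (n * finrank k E) * μ (closedBall 0 R) := by
  have := FiniteDimensional.proper k E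
  have hball : closedBall 0 (‖(u : k)‖ ^ n * R) = (u ^ n) • closedBall (0 : E) R := by
    rw [Units.smul_def, _root_.smul_closedBall _ _ hR, smul_zero,
      Units.val_pow_eq_pow_val, norm_pow]
  rw [Measure.addHaar_closedBall_center, hball, measure_units_smul_set (k := k), map_pow, pow_mul,
    ENNReal.coe_pow]

theorem coveringNumber_mul_measure_closedBall_le {G : Type*} [NormedAddCommGroup G]
    [MeasurableSpace G] [BorelSpace G] (μ : Measure G) [μ.IsAddHaarMeasure] (ε : ℝ≥0) (S : Set G) :
    (coveringNumber ε S : ℝ≥0∞) * μ (closedBall 0 (ε / 2)) ≤ μ (cthickening (ε / 2) S) := by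
  suffices h : ∀ C ⊆ S, IsSeparated ε C →
      (C.encard : ℝ≥0∞) * μ (closedBall 0 (ε / 2)) ≤ μ (cthickening (ε / 2) S) by
    refine (mul_le_mul_left (ENat.toENNReal_le.2 (coveringNumber_le_packingNumber ε S)) _).trans ?_
    simp only [packingNumber, ENat.toENNReal_iSup, ENNReal.iSup_mul, iSup_le_iff]
    exact h
  intro C hCS hC
  have hdisj : Pairwise (Function.onFun Disjoint fun x : C => closedBall (x : G) (ε / 2)) := by
    intro x y hxy
    have hd : (ε : ℝ≥0∞) < edist (x : G) y := hC x.2 y.2 (Subtype.coe_injective.ne hxy)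
    rw [edist_nndist, ENNReal.coe_lt_coe] at hd
    refine closedBall_disjoint_closedBall ?_
    rwa [add_halves, dist_nndist, NNReal.coe_lt_coe]
  calc (C.encard : ℝ≥0∞) * μ (closedBall 0 (ε / 2))
      = ∑' x : C, μ (closedBall (x : G) (ε / 2)) := by
        simp only [Measure.addHaar_closedBall_center, ENNReal.tsum_const]
        rfl
    _ ≤ μ (⋃ x : C, closedBall (x : G) (ε / 2)) :=
        tsum_meas_le_meas_iUnion_of_disjoint μ (fun x => measurableSet_closedBall) hdisj
    _ ≤ μ (cthickening (ε / 2) S) :=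
        measure_mono (iUnion_subset fun x => closedBall_subset_cthickening (hCS x.2) _)

theorem exists_forall_coveringNumber_norm_pow_mul_le {u : kˣ} (hu : ‖(u : k)‖ ≤ 1)
    {S : Set E} (hS : Bornology.IsBounded S) :
    ∃ M : ℝ≥0∞, M ≠ ⊤ ∧ ∀ n : ℕ,
      (coveringNumber (‖(u : k)‖₊ ^ n) S : ℝ≥0∞) *
        distribHaarChar k u ^ (n * finrank k E) ≤ M := by
  borelize E
  have := FiniteDimensional.proper k E
  let μ : Measure E := Measure.addHaar
  let b := μ (closedBall 0 (1 / 2))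
  have hb : b ≠ 0 := (measure_closedBall_pos μ 0 (by norm_num)).ne'
  refine ⟨μ (cthickening (1 / 2) S) / b,
    ENNReal.div_ne_top hS.cthickening.measure_lt_top.ne hb, fun n => ?_⟩
  rw [ENNReal.le_div_iff_mul_le (.inl hb) (.inl measure_closedBall_lt_top.ne), mul_assoc,
    ← measure_closedBall_norm_pow_mul μ u 0 (by norm_num), mul_one_div]
  have hcover := coveringNumber_mul_measure_closedBall_le μ (‖(u : k)‖₊ ^ n) S
  push_cast at hcover
  refine hcover.trans (measure_mono (cthickening_mono ?_ S))
  gcongr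
  exact pow_le_one₀ (norm_nonneg _) hu

variable {F : Type*} [NormedAddCommGroup F] [NormedSpace k F] [FiniteDimensional k F]
  [MeasurableSpace F] [BorelSpace F]

theorem measure_image_le_coveringNumber_mul {α : Type*} [PseudoMetricSpace α]
    (ν : Measure F) [ν.IsAddHaarMeasure] {f : α → F} {S : Set α} {r : ℝ≥0} {ρ : ℝ}
    (hS : coveringNumber r S ≠ ⊤)
    (hf : ∀ x ∈ S, ∀ y ∈ S, dist y x ≤ r → dist (f y) (f x) ≤ ρ) :
    ν (f '' S) ≤ coveringNumber r S * ν (closedBall 0 ρ) := by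
  obtain ⟨A, hAS, hAfin, hcover, hcard⟩ := exists_set_encard_eq_coveringNumber hS
  have hsub : f '' S ⊆ ⋃ x ∈ A, closedBall (f x) ρ := by
    rintro _ ⟨y, hy, rfl⟩
    obtain ⟨x, hx, hyx⟩ := hcover hy
    exact mem_biUnion hx (hf x (hAS hx) y hy (by simpa [edist_le_coe] using hyx))
  calc ν (f '' S) ≤ ∑' x : A, ν (closedBall (f x) ρ) :=
        (measure_mono hsub).trans (measure_biUnion_le ν hAfin.countable _)
    _ = coveringNumber r S * ν (closedBall 0 ρ) := by
        simp only [Measure.addHaar_closedBall_center, ENNReal.tsum_const, ← hcard]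
        rfl

theorem measure_image_le_coveringNumber_mul_distribHaarChar_pow {α : Type*} [PseudoMetricSpace α]
    (ν : Measure F) [ν.IsAddHaarMeasure] {f : α → F} {S : Set α} {u : kˣ} {n d : ℕ} {C : ℝ}
    (hC : 0 ≤ C) (hS : coveringNumber (‖(u : k)‖₊ ^ n) S ≠ ⊤)
    (hf : ∀ x ∈ S, ∀ y ∈ S, dist y x ≤ ‖(u : k)‖ ^ n → dist (f y) (f x) ≤ C * dist y x ^ d) :
    ν (f '' S) ≤ coveringNumber (‖(u : k)‖₊ ^ n) S *
      ((distribHaarChar k u : ℝ≥0∞) ^ (n * d * finrank k F) * ν (closedBall 0 C)) := by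
  rw [← measure_closedBall_norm_pow_mul ν u 0 hC]
  refine measure_image_le_coveringNumber_mul ν hS fun x hx y hy hyx => ?_
  calc dist (f y) (f x) ≤ C * dist y x ^ d := hf x hx y hy hyx
    _ ≤ C * (‖(u : k)‖ ^ n) ^ d := by
        gcongr
        exact hyx
    _ = ‖(u : k)‖ ^ (n * d) * C := by rw [pow_mul, mul_comm]

theorem exists_forall_measure_image_le_mul_pow (ν : Measure F) [ν.IsAddHaarMeasure] {d : ℕ}
    (hd : finrank k E < d * finrank k F) {f : E → F} {S : Set E}
    (hS : Bornology.IsBounded S) {C ε : ℝ} (hC : 0 ≤ C)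
    (hf : ∀ x ∈ S, ∀ y ∈ S, dist y x < ε → ‖f y - f x‖ ≤ C * ‖y - x‖ ^ d)
    {u : kˣ} (hu : ‖(u : k)‖ < 1) :
    ∃ M : ℝ≥0∞, M ≠ ⊤ ∧
      ∀ n : ℕ, ‖(u : k)‖ ^ n < ε → ν (f '' S) ≤ M * (distribHaarChar k u : ℝ≥0∞) ^ n := by
  have := FiniteDimensional.proper k F
  obtain ⟨M, hM, hcount⟩ := exists_forall_coveringNumber_norm_pow_mul_le hu.le hS
  set δ : ℝ≥0∞ := ((distribHaarChar k u : ℝ≥0) : ℝ≥0∞)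
  have hδ : δ ≤ 1 := ENNReal.coe_le_one_iff.2 (distribHaarChar_lt_one_of_norm_lt_one hu).le
  have hδ0 : δ ≠ 0 := ENNReal.coe_ne_zero.2 distribHaarChar_pos.ne'
  refine ⟨M * ν (closedBall 0 C), ENNReal.mul_ne_top hM measure_closedBall_lt_top.ne,
    fun n hn => ?_⟩
  have hfin : coveringNumber (‖(u : k)‖₊ ^ n) S ≠ ⊤ := fun htop => hM <| top_le_iff.1 <| by
    simpa only [htop, ENat.toENNReal_top, ENNReal.top_mul (pow_ne_zero _ hδ0)] using hcount n
  have hexp : n * finrank k E + n ≤ n * d * finrank k F := by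
    rw [← Nat.mul_succ, mul_assoc]
    exact Nat.mul_le_mul_left n hd
  calc ν (f '' S)
      ≤ coveringNumber (‖(u : k)‖₊ ^ n) S * (δ ^ (n * d * finrank k F) * ν (closedBall 0 C)) :=
        measure_image_le_coveringNumber_mul_distribHaarChar_pow ν hC hfin
          fun x hx y hy hyx => by
            simpa only [dist_eq_norm] using hf x hx y hy (hyx.trans_lt hn)
    _ ≤ coveringNumber (‖(u : k)‖₊ ^ n) S *
          (δ ^ (n * finrank k E + n) * ν (closedBall 0 C)) := by
        gcongr _ * (?_ * _)
        exact pow_le_pow_right_of_le_one' hδ hexp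
    _ = coveringNumber (‖(u : k)‖₊ ^ n) S * δ ^ (n * finrank k E) *
          ν (closedBall 0 C) * δ ^ n := by ring
    _ ≤ M * ν (closedBall 0 C) * δ ^ n := by
        gcongr
        exact hcount n

theorem measure_image_eq_zero_of_norm_sub_le_pow (ν : Measure F) [ν.IsAddHaarMeasure] {d : ℕ}
    (hd : finrank k E < d * finrank k F) {f : E → F} {S : Set E}
    (hS : Bornology.IsBounded S) {C ε : ℝ} (hC : 0 ≤ C) (hε : 0 < ε)
    (hf : ∀ x ∈ S, ∀ y ∈ S, dist y x < ε → ‖f y - f x‖ ≤ C * ‖y - x‖ ^ d) :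
    ν (f '' S) = 0 := by
  obtain ⟨a, ha0, ha1⟩ := NormedField.exists_norm_lt_one k
  let u : kˣ := Units.mk0 a (norm_pos_iff.1 ha0)
  obtain ⟨M, hM, hle⟩ := exists_forall_measure_image_le_mul_pow ν hd hS hC hf (u := u) ha1
  have hlim : Tendsto (fun n => M * (distribHaarChar k u : ℝ≥0∞) ^ n) atTop (𝓝 0) := by
    simpa using ENNReal.Tendsto.const_mul (ENNReal.tendsto_pow_atTop_nhds_zero_of_lt_one <|
      ENNReal.coe_lt_one_iff.2 (distribHaarChar_lt_one_of_norm_lt_one (u := u) ha1)) (.inr hM)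
  have hsmall := (tendsto_pow_atTop_nhds_zero_of_lt_one ha0.le ha1).eventually_lt_const hε
  exact le_antisymm (ge_of_tendsto hlim (hsmall.mono hle)) zero_le

theorem measure_image_eq_zero_of_isBigO (ν : Measure F) [ν.IsAddHaarMeasure] {d : ℕ}
    (hd : finrank k E < d * finrank k F) {f : E → F} {S : Set E}
    (hf : ∀ x ∈ S, (fun y => f y - f x) =O[𝓝 x] fun y => ‖y - x‖ ^ d) : ν (f '' S) = 0 := by
  let T (N : ℕ) : Set E := {x | ‖x‖ ≤ N ∧
    ∀ y, dist y x < 1 / ((N : ℝ) + 1) → ‖f y - f x‖ ≤ N * ‖y - x‖ ^ d}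
  have hcov : S ⊆ ⋃ N, T N := by
    intro x hx
    obtain ⟨C, hC⟩ := (hf x hx).bound
    obtain ⟨ε, hε, hball⟩ := Metric.eventually_nhds_iff.1 hC
    have hinv := tendsto_one_div_add_atTop_nhds_zero_nat (𝕜 := ℝ)
    obtain ⟨N, hNx, hNC, hNε⟩ := ((tendsto_natCast_atTop_atTop.eventually_ge_atTop ‖x‖).and
      ((tendsto_natCast_atTop_atTop.eventually_ge_atTop C).and
        (hinv.eventually_lt_const hε))).exists
    refine mem_iUnion.2 ⟨N, hNx, fun y hy => ?_⟩
    have hle := hball (hy.trans hNε)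
    rw [norm_pow, norm_norm] at hle
    exact hle.trans (by gcongr)
  refine measure_mono_null ((image_mono hcov).trans (image_iUnion ..).subset)
    (measure_iUnion_null fun N => ?_)
  refine measure_image_eq_zero_of_norm_sub_le_pow ν hd ?_ N.cast_nonneg
    (ε := 1 / ((N : ℝ) + 1)) (by positivity) fun x hx y _ => hx.2 y
  exact isBounded_iff_forall_norm_le.2 ⟨N, fun x hx => hx.1⟩

end HaarMeasure

section NullSets

theorem measure_image_null_of_locally_null {α β : Type*} [TopologicalSpace α]
    [SecondCountableTopology α] [MeasurableSpace β] {μ : Measure β} {f : α → β} {S : Set α}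
    (h : ∀ x ∈ S, ∃ U ∈ 𝓝 x, μ (f '' (S ∩ U)) = 0) : μ (f '' S) = 0 := by
  choose! U hU hμ using h
  obtain ⟨t, htS, htc, hcov⟩ := TopologicalSpace.countable_cover_nhdsWithin
    (fun x hx => mem_nhdsWithin_of_mem_nhds (hU x hx))
  have hsub : f '' S ⊆ ⋃ x ∈ t, f '' (S ∩ U x) := by
    rintro _ ⟨x, hx, rfl⟩
    obtain ⟨y, hy, hxy⟩ := mem_iUnion₂.1 (hcov hx)
    exact mem_biUnion hy ⟨x, ⟨hx, hxy⟩, rfl⟩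
  exact measure_mono_null hsub ((measure_biUnion_null_iff htc).2 fun x hx => hμ x (htS hx))

theorem measurableSet_image_of_isLocallyClosed {α β : Type*} [TopologicalSpace α]
    [LocallyCompactSpace α] [SecondCountableTopology α] [TopologicalSpace β] [T2Space β]
    [MeasurableSpace β] [BorelSpace β] {g : α → β} {S : Set α} (hS : IsLocallyClosed S)
    (hg : ContinuousOn g S) : MeasurableSet (g '' S) := by
  have := hS.locallyCompactSpace
  have hσ : IsSigmaCompact S := isSigmaCompact_iff_sigmaCompactSpace.2 inferInstance
  obtain ⟨K, hK, hKimage⟩ := hσ.image_of_continuousOn hg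
  rw [← hKimage]
  exact MeasurableSet.iUnion fun n => (hK n).measurableSet

theorem measure_eq_zero_of_image_continuousLinearEquiv {k F F' : Type*} [NontriviallyNormedField k]
    [NormedAddCommGroup F] [NormedSpace k F] [ProperSpace F] [MeasurableSpace F] [BorelSpace F]
    [NormedAddCommGroup F'] [NormedSpace k F'] [MeasurableSpace F'] [BorelSpace F']
    (ν : Measure F) [ν.IsAddHaarMeasure] (ν' : Measure F') [ν'.IsAddHaarMeasure]
    (B : F ≃L[k] F') {s : Set F} (h : ν' (B '' s) = 0) : ν s = 0 := by
  have := B.symm.isAddHaarMeasure_map ν'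
  refine Measure.absolutelyContinuous_isAddHaarMeasure ν (ν'.map B.symm) ?_
  rw [B.image_eq_preimage_symm] at h
  exact (B.symm.toHomeomorph.toMeasurableEquiv.map_apply s).trans h

end NullSets

section Linear

variable {k : Type*} [NontriviallyNormedField k]
  {E F : Type*} [NormedAddCommGroup E] [NormedSpace k E] [NormedAddCommGroup F] [NormedSpace k F]

theorem finrank_ker_add_one [FiniteDimensional k F] {ℓ : F →L[k] k} (hℓ : ℓ ≠ 0) :
    finrank k ℓ.ker + 1 = finrank k F :=
  Module.Dual.finrank_ker_add_one_of_ne_zero (f := (ℓ : F →ₗ[k] k))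
    (ContinuousLinearMap.coe_injective.ne hℓ)

theorem exists_continuousLinearEquiv_prod_ker {ℓ : F →L[k] k} (hℓ : ℓ ≠ 0) :
    ∃ B : F ≃L[k] k × ℓ.ker, ∀ v, (B v).1 = ℓ v := by
  obtain ⟨v, hv⟩ := DFunLike.ne_iff.1 hℓ
  refine ⟨.equivOfRightInverse ℓ (.toSpanSingleton k ((ℓ v)⁻¹ • v)) fun t => ?_, fun _ => rfl⟩
  rw [ContinuousLinearMap.toSpanSingleton_apply, map_smul, map_smul, smul_eq_mul, smul_eq_mul,
    inv_mul_cancel₀ hv, mul_one]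

variable [CompleteSpace k]

theorem isOpen_setOf_surjective [FiniteDimensional k F] :
    IsOpen {L : E →L[k] F | Function.Surjective L} := by
  have := FiniteDimensional.complete k F
  rw [isOpen_iff_mem_nhds]
  intro L₀ hL₀
  obtain ⟨R, hR⟩ := (L₀ : E →ₗ[k] F).exists_rightInverse_of_surjective
    (LinearMap.range_eq_top.2 hL₀)
  let comp (L : E →L[k] F) : F →L[k] F := L.comp (LinearMap.toContinuousLinearMap R)
  have hcont : Continuous comp := continuous_id.clm_comp continuous_const
  have hone : comp L₀ = 1 := ContinuousLinearMap.ext fun x => LinearMap.congr_fun hR x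
  have hunit : ∀ᶠ L in 𝓝 L₀, IsUnit (comp L) :=
    hcont.continuousAt.eventually (Units.isOpen.mem_nhds (hone ▸ isUnit_one))
  filter_upwards [hunit] with L ⟨v, hv⟩ y
  refine ⟨R ((↑v⁻¹ : F →L[k] F) y), ?_⟩
  change comp L ((↑v⁻¹ : F →L[k] F) y) = y
  rw [← hv, ← mul_apply_eq_comp, Units.mul_inv, one_apply_eq_self]

theorem exists_continuousLinearMap_apply_ne_zero [FiniteDimensional k F] {y : F} (hy : y ≠ 0) :
    ∃ ℓ : F →L[k] k, ℓ y ≠ 0 := by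
  obtain ⟨ℓ, hℓ⟩ := not_forall.1 (mt (Module.forall_dual_apply_eq_zero_iff k y).1 hy)
  exact ⟨LinearMap.toContinuousLinearMap ℓ, hℓ⟩

end Linear

section Analytic

variable {k : Type*} [NontriviallyNormedField k]
  {E F : Type*} [NormedAddCommGroup E] [NormedSpace k E] [NormedAddCommGroup F] [NormedSpace k F]

theorem isBigO_sub_pow_succ_of_iteratedFDeriv_eq_zero [CompleteSpace F] {d : ℕ}
    (hd : (d.factorial : k) ≠ 0) {f : E → F} {x : E} (hf : AnalyticAt k f x)
    (h : ∀ i, 1 ≤ i → i ≤ d → iteratedFDeriv k i f x = 0) :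
    (fun y => f y - f x) =O[𝓝 x] fun y => ‖y - x‖ ^ (d + 1) := by
  obtain ⟨P, hP⟩ := hf
  obtain ⟨ρ, hρ⟩ := id hP
  have hterm (y : E) (i : ℕ) (hi1 : 1 ≤ i) (hid : i ≤ d) : P i (fun _ => y) = 0 := by
    have hfact := hρ.factorial_smul y i
    rw [h i hi1 hid, zero_apply, ← Nat.cast_smul_eq_nsmul k] at hfact
    refine (smul_eq_zero.1 hfact).resolve_left fun hi => hd ?_
    exact zero_dvd_iff.1 (hi ▸ Nat.cast_dvd_cast (Nat.factorial_dvd_factorial hid))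
  have hsum (y : E) : P.partialSum (d + 1) y = f x := by
    rw [FormalMultilinearSeries.partialSum, Finset.sum_eq_single_of_mem 0 (by simp)]
    · exact hP.coeff_zero _
    · exact fun i hi hi0 => hterm y i (Nat.one_le_iff_ne_zero.2 hi0)
        (Nat.lt_succ_iff.1 (Finset.mem_range.1 hi))
  have hO := hP.isBigO_sub_partialSum_pow (d + 1)
  simp only [hsum] at hO
  have hlim : Tendsto (fun y => y - x) (𝓝 x) (𝓝 0) := tendsto_sub_nhds_zero_iff.2 tendsto_id
  simpa [Function.comp_def] using hO.comp_tendsto hlim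

theorem exists_analyticOnNhd_rightInverse [CompleteSpace E] {Ψ : E → F} {x₀ : E}
    (hΨ : AnalyticAt k Ψ x₀) {i : E ≃L[k] F} (hi : (i : E →L[k] F) = fderiv k Ψ x₀) {U : Set E}
    (hU : U ∈ 𝓝 x₀) :
    ∃ (φ : F → E) (T : Set F), IsOpen T ∧ AnalyticOnNhd k φ T ∧ MapsTo φ T U ∧
      (∀ z ∈ T, Ψ (φ z) = z) ∧ φ '' T ∈ 𝓝 x₀ := by
  have hstrict : HasStrictFDerivAt Ψ (i : E →L[k] F) x₀ := hi ▸ hΨ.hasStrictFDerivAt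
  let e := hstrict.toOpenPartialHomeomorph Ψ
  have hx₀ : x₀ ∈ e.source := hstrict.mem_toOpenPartialHomeomorph_source
  have hsymm : AnalyticAt k e.symm (e x₀) := e.analyticAt_symm' hx₀ hΨ hi.symm
  let G : Set F := {z | AnalyticAt k e.symm z ∧ e.symm z ∈ U}
  have hG : G ∈ 𝓝 (e x₀) :=
    hsymm.eventually_analyticAt.and (hsymm.continuousAt (by rwa [e.left_inv hx₀]))
  refine ⟨e.symm, e.target ∩ interior G, e.open_target.inter isOpen_interior,
    fun z hz => (interior_subset hz.2).1, fun z hz => (interior_subset hz.2).2,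
    fun z hz => e.right_inv hz.1, ?_⟩
  filter_upwards [e.open_source.mem_nhds hx₀,
    (e.continuousAt hx₀).eventually (interior_mem_nhds.2 hG)] with x hx hxG
  exact ⟨e x, ⟨e.map_source hx, hxG⟩, e.left_inv hx⟩

theorem exists_analyticOnNhd_parametrization [CompleteSpace E] {w : E → k} {x₀ : E}
    (hw : AnalyticAt k w x₀) (hdw : fderiv k w x₀ ≠ 0) {U : Set E} (hU : U ∈ 𝓝 x₀) :
    ∃ (φ : k × (fderiv k w x₀).ker → E) (T : Set (k × (fderiv k w x₀).ker)),
      IsOpen T ∧ AnalyticOnNhd k φ T ∧ MapsTo φ T U ∧ (∀ z ∈ T, w (φ z) = z.1) ∧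
        φ '' T ∈ 𝓝 x₀ := by
  obtain ⟨B, hB⟩ := exists_continuousLinearEquiv_prod_ker hdw
  let q : E →L[k] (fderiv k w x₀).ker := (ContinuousLinearMap.snd k k _).comp (B : E →L[k] _)
  let Ψ : E → k × (fderiv k w x₀).ker := fun x => (w x, q x)
  have hΨ' : HasFDerivAt Ψ ((fderiv k w x₀).prod q) x₀ :=
    hw.differentiableAt.hasFDerivAt.prodMk q.hasFDerivAt
  have hBΨ : (B : E →L[k] _) = fderiv k Ψ x₀ := by
    rw [hΨ'.fderiv]
    exact ContinuousLinearMap.ext fun v => Prod.ext (hB v) rfl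
  obtain ⟨φ, T, hT, hφ, hφU, hΨφ, hcov⟩ :=
    exists_analyticOnNhd_rightInverse (hw.prod (q.analyticAt x₀)) hBΨ hU
  exact ⟨φ, T, hT, hφ, hφU, fun z hz => congrArg Prod.fst (hΨφ z hz), hcov⟩

end Analytic

section Sard

variable {k : Type*} [NontriviallyNormedField k]
  {E F : Type*} [NormedAddCommGroup E] [NormedSpace k E] [NormedAddCommGroup F] [NormedSpace k F]

variable (k) in
/-- The critical points in `U` of a map `f` between normed spaces. -/
def criticalPoints (f : E → F) (U : Set E) : Set E :=
  {x ∈ U | ¬ Function.Surjective (fderiv k f x)}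

variable (k E F) in
/-- Sard's theorem for `k`-analytic maps from open subsets of `E` to `F`, as a property of the pair
of spaces `(E, F)`; it is the statement that is proved by induction on the dimension of `E`. -/
def HasNullCriticalValues [MeasurableSpace F] : Prop :=
  ∀ ν : Measure F, ν.IsAddHaarMeasure → ∀ (f : E → F) (U : Set E), IsOpen U →
    AnalyticOnNhd k f U → ν (f '' criticalPoints k f U) = 0

theorem surjective_fderiv_of_surjective_fderiv_comp {G : Type*} [NormedAddCommGroup G]
    [NormedSpace k G] {f : E → F} {φ : G → E} {z : G} (hf : DifferentiableAt k f (φ z))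
    (hφ : DifferentiableAt k φ z) (h : Function.Surjective (fderiv k (f ∘ φ) z)) :
    Function.Surjective (fderiv k f (φ z)) := by
  rw [fderiv_comp z hf hφ] at h
  exact Function.Surjective.of_comp h

theorem surjective_of_surjective_snd_comp_inr {L : k × E →L[k] k × F} (hfst : ∀ v, (L v).1 = v.1)
    (hsnd : Function.Surjective fun y : E => (L (0, y)).2) : Function.Surjective L := by
  rintro ⟨c, u⟩
  obtain ⟨y, hy : (L (0, y)).2 = _⟩ := hsnd (u - (L (c, 0)).2)
  refine ⟨(c, 0) + (0, y), Prod.ext ?_ ?_⟩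
  · simp [hfst]
  · rw [map_add, Prod.snd_add, hy, add_sub_cancel]

theorem surjective_fderiv_of_surjective_fderiv_slice {g : k × E → k × F} {z : k × E}
    (hg : DifferentiableAt k g z) (hfst : ∀ᶠ z' in 𝓝 z, (g z').1 = z'.1)
    (hslice : Function.Surjective (fderiv k (fun y => (g (z.1, y)).2) z.2)) :
    Function.Surjective (fderiv k g z) := by
  have hslice' : HasFDerivAt (fun y => (g (z.1, y)).2) ((ContinuousLinearMap.snd k k F).comp
      ((fderiv k g z).comp (ContinuousLinearMap.inr k k E))) z.2 :=
    hasFDerivAt_snd.comp z.2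
      (HasFDerivAt.comp (g := g) z.2 hg.hasFDerivAt (hasFDerivAt_prodMk_right z.1 z.2))
  have hfst' : (ContinuousLinearMap.fst k k F).comp (fderiv k g z) =
      ContinuousLinearMap.fst k k E :=
    (hasFDerivAt_fst.comp z hg.hasFDerivAt).unique (hasFDerivAt_fst.congr_of_eventuallyEq hfst)
  rw [hslice'.fderiv] at hslice
  exact surjective_of_surjective_snd_comp_inr (fun v => DFunLike.congr_fun hfst' v) hslice

theorem isLocallyClosed_criticalPoints [CompleteSpace k] [FiniteDimensional k F] {f : E → F}
    {U : Set E} (hU : IsOpen U) (hf : AnalyticOnNhd k f U) :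
    IsLocallyClosed (criticalPoints k f U) := by
  have := FiniteDimensional.complete k F
  have hreg : IsOpen (U ∩ fderiv k f ⁻¹' {L | Function.Surjective L}) :=
    hf.fderiv.continuousOn.isOpen_inter_preimage hU isOpen_setOf_surjective
  have hcrit : criticalPoints k f U = U ∩ (U ∩ fderiv k f ⁻¹' {L | Function.Surjective L})ᶜ := by
    ext x
    simp only [criticalPoints, mem_inter_iff, mem_compl_iff, mem_preimage, mem_ofPred_eq]
    tauto
  exact hcrit ▸ hU.isLocallyClosed.inter hreg.isClosed_compl.isLocallyClosed

theorem criticalPoints_subset_union (f : E → F) (U : Set E) (d : ℕ) :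
    criticalPoints k f U ⊆ {x ∈ criticalPoints k f U | fderiv k f x ≠ 0} ∪
      ((⋃ i, {x ∈ U | fderiv k f x = 0 ∧ iteratedFDeriv k i f x = 0 ∧
        iteratedFDeriv k (i + 1) f x ≠ 0}) ∪
      {x ∈ U | ∀ i, 1 ≤ i → i ≤ d → iteratedFDeriv k i f x = 0}) := by
  intro x hx
  by_cases hdf : fderiv k f x ≠ 0
  · exact .inl ⟨hx, hdf⟩
  rw [not_not] at hdf
  by_cases hstep : ∃ i, iteratedFDeriv k i f x = 0 ∧ iteratedFDeriv k (i + 1) f x ≠ 0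
  · obtain ⟨i, hi⟩ := hstep
    exact .inr (.inl (mem_iUnion.2 ⟨i, hx.1, hdf, hi⟩))
  · push Not at hstep
    have hone : iteratedFDeriv k 1 f x = 0 := by
      ext v
      rw [iteratedFDeriv_one_apply, hdf, zero_apply, zero_apply]
    exact .inr (.inr ⟨hx.1, fun i hi _ => Nat.le_induction hone (fun j _ => hstep j) i hi⟩)

variable [ProperSpace k] [FiniteDimensional k E] [MeasurableSpace F]

theorem exists_mem_nhds_measure_image_setOf_fderiv_eq_zero [Nontrivial F] {f : E → F} {U : Set E}
    (hU : IsOpen U) (hf : AnalyticOnNhd k f U) {w : E → k} {x₀ : E} (hx₀ : x₀ ∈ U)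
    (hw : AnalyticAt k w x₀) (hdw : fderiv k w x₀ ≠ 0)
    (ih : HasNullCriticalValues k (fderiv k w x₀).ker F) (ν : Measure F) [ν.IsAddHaarMeasure] :
    ∃ V ∈ 𝓝 x₀, ν (f '' ({x ∈ U | fderiv k f x = 0 ∧ w x = 0} ∩ V)) = 0 := by
  have := FiniteDimensional.complete k E
  obtain ⟨φ, T, hT, hφ, hφU, hφw, hcov⟩ :=
    exists_analyticOnNhd_parametrization hw hdw (hU.mem_nhds hx₀)
  let ψ : (fderiv k w x₀).ker → E := fun y => φ (0, y)
  have hψ : AnalyticOnNhd k ψ (Prod.mk 0 ⁻¹' T) := fun y hy =>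
    AnalyticAt.comp (g := φ) (hφ _ hy) (analyticAt_const.prod analyticAt_id)
  refine ⟨_, hcov, measure_mono_null ?_ (ih ν inferInstance (f ∘ ψ) _
    (hT.preimage (by fun_prop)) (hf.comp hψ fun y hy => hφU hy))⟩
  rintro _ ⟨_, ⟨⟨hxU, hdf, hwx⟩, ⟨t, y⟩, hz, rfl⟩, rfl⟩
  obtain rfl : t = 0 := (hφw _ hz).symm.trans hwx
  refine ⟨y, ⟨hz, fun hsurj => ?_⟩, rfl⟩
  have hsurj₀ := surjective_fderiv_of_surjective_fderiv_comp (φ := ψ)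
    (hf _ hxU).differentiableAt (hψ y hz).differentiableAt hsurj
  obtain ⟨u, hu⟩ := exists_ne (0 : F)
  obtain ⟨v, hv⟩ := hsurj₀ u
  exact hu (hv.symm.trans (DFunLike.congr_fun hdf v))

variable [FiniteDimensional k F]

theorem measure_image_setOf_iteratedFDeriv_succ_ne_zero [Nontrivial F] (i : ℕ)
    (ih : ∀ ℓ : E →L[k] k, ℓ ≠ 0 → HasNullCriticalValues k ℓ.ker F)
    {f : E → F} {U : Set E} (hU : IsOpen U) (hf : AnalyticOnNhd k f U)
    (ν : Measure F) [ν.IsAddHaarMeasure] :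
    ν (f '' {x ∈ U | fderiv k f x = 0 ∧ iteratedFDeriv k i f x = 0 ∧
      iteratedFDeriv k (i + 1) f x ≠ 0}) = 0 := by
  have := FiniteDimensional.complete k F
  have := FiniteDimensional.proper k E
  refine measure_image_null_of_locally_null fun x₀ ⟨hx₀U, _, _, hne⟩ => ?_
  obtain ⟨M, hM⟩ := DFunLike.ne_iff.1 hne
  rw [iteratedFDeriv_succ_apply_left] at hM
  obtain ⟨ℓ, hℓ⟩ := exists_continuousLinearMap_apply_ne_zero (k := k) hM
  let Λ : (E [×i]→L[k] F) →L[k] k := ℓ.comp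
    (ContinuousMultilinearMap.apply k (fun _ : Fin i => E) F (Fin.tail M))
  have hD : AnalyticAt k (iteratedFDeriv k i f) x₀ := hf.iteratedFDeriv i x₀ hx₀U
  have hw : AnalyticAt k (Λ ∘ iteratedFDeriv k i f) x₀ := (Λ.analyticAt _).comp hD
  have hdw : fderiv k (Λ ∘ iteratedFDeriv k i f) x₀ ≠ 0 := by
    rw [(Λ.hasFDerivAt.comp x₀ hD.differentiableAt.hasFDerivAt).fderiv]
    exact DFunLike.ne_iff.2 ⟨M 0, hℓ⟩
  obtain ⟨V, hV, hnull⟩ := exists_mem_nhds_measure_image_setOf_fderiv_eq_zero hU hf hx₀U hw hdw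
    (ih _ hdw) ν
  refine ⟨V, hV, measure_mono_null (image_mono (inter_subset_inter_left V ?_)) hnull⟩
  rintro x ⟨hxU, hdf, hi, -⟩
  exact ⟨hxU, hdf, (congrArg Λ hi).trans (map_zero Λ)⟩

variable [BorelSpace F]

theorem measure_image_criticalPoints_of_fst_eq (hEF : HasNullCriticalValues k E F)
    [MeasurableSpace k] [BorelSpace k]
    {g : k × E → k × F} {T : Set (k × E)} (hT : IsOpen T) (hg : AnalyticOnNhd k g T)
    (hfst : ∀ z ∈ T, (g z).1 = z.1) (ν : Measure (k × F)) [ν.IsAddHaarMeasure] :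
    ν (g '' criticalPoints k g T) = 0 := by
  have := FiniteDimensional.proper k E
  have := FiniteDimensional.proper k F
  have hmeas : MeasurableSet (g '' criticalPoints k g T) :=
    measurableSet_image_of_isLocallyClosed (isLocallyClosed_criticalPoints hT hg)
      (hg.continuousOn.mono fun z hz => hz.1)
  refine Measure.absolutelyContinuous_isAddHaarMeasure ν (Measure.addHaar.prod Measure.addHaar) ?_
  refine (Measure.measure_prod_null hmeas).2 (Eventually.of_forall fun c => ?_)
  have hslice : AnalyticOnNhd k (fun y => (g (c, y)).2) (Prod.mk c ⁻¹' T) := fun y hy =>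
    analyticAt_snd.comp (AnalyticAt.comp (g := g) (hg _ hy) (analyticAt_const.prod analyticAt_id))
  refine measure_mono_null ?_
    (hEF Measure.addHaar inferInstance _ _ (hT.preimage (by fun_prop)) hslice)
  rintro u ⟨⟨a, y⟩, ⟨hzT, hcrit⟩, hz⟩
  obtain rfl : a = c := (hfst _ hzT).symm.trans (congrArg Prod.fst hz)
  refine ⟨y, ⟨hzT, fun hsurj => hcrit ?_⟩, congrArg Prod.snd hz⟩
  exact surjective_fderiv_of_surjective_fderiv_slice (hg _ hzT).differentiableAt
    (eventually_of_mem (hT.mem_nhds hzT) hfst) hsurj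

theorem measure_image_criticalPoints_fderiv_ne_zero
    (ih : ∀ (ℓ : E →L[k] k) (ℓ' : F →L[k] k), ℓ ≠ 0 → ℓ' ≠ 0 →
      HasNullCriticalValues k ℓ.ker ℓ'.ker)
    {f : E → F} {U : Set E} (hU : IsOpen U) (hf : AnalyticOnNhd k f U)
    (ν : Measure F) [ν.IsAddHaarMeasure] :
    ν (f '' {x ∈ criticalPoints k f U | fderiv k f x ≠ 0}) = 0 := by
  borelize k
  have := FiniteDimensional.complete k E
  have := FiniteDimensional.proper k E
  have := FiniteDimensional.proper k F
  refine measure_image_null_of_locally_null fun x₀ ⟨⟨hx₀U, _⟩, hne⟩ => ?_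
  obtain ⟨v, hv⟩ := DFunLike.ne_iff.1 hne
  obtain ⟨ℓ, hℓv⟩ := exists_continuousLinearMap_apply_ne_zero (k := k) hv
  have hℓ : ℓ ≠ 0 := by
    rintro rfl
    exact hℓv rfl
  have hw : AnalyticAt k (ℓ ∘ f) x₀ := (ℓ.analyticAt _).comp (hf x₀ hx₀U)
  have hdw : fderiv k (ℓ ∘ f) x₀ ≠ 0 := by
    rw [(ℓ.hasFDerivAt.comp x₀ (hf x₀ hx₀U).differentiableAt.hasFDerivAt).fderiv]
    exact DFunLike.ne_iff.2 ⟨v, hℓv⟩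
  obtain ⟨φ, T, hT, hφ, hφU, hφw, hcov⟩ :=
    exists_analyticOnNhd_parametrization hw hdw (hU.mem_nhds hx₀U)
  obtain ⟨B, hB⟩ := exists_continuousLinearEquiv_prod_ker hℓ
  have hfφ : AnalyticOnNhd k (f ∘ φ) T := hf.comp hφ hφU
  have hg : AnalyticOnNhd k (B ∘ f ∘ φ) T := B.analyticOnNhd univ |>.comp hfφ (mapsTo_univ _ _)
  have hnull := measure_image_criticalPoints_of_fst_eq (ih _ _ hdw hℓ) hT hg
    (fun z hz => (hB _).trans (hφw z hz)) Measure.addHaar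
  refine ⟨_, hcov, measure_eq_zero_of_image_continuousLinearEquiv ν Measure.addHaar B
    (measure_mono_null ?_ hnull)⟩
  rintro _ ⟨_, ⟨_, ⟨⟨⟨hxU, hcrit⟩, -⟩, z, hz, rfl⟩, rfl⟩, rfl⟩
  refine ⟨z, ⟨hz, fun hsurj => hcrit ?_⟩, rfl⟩
  refine surjective_fderiv_of_surjective_fderiv_comp (hf _ hxU).differentiableAt
    (hφ z hz).differentiableAt ?_
  rw [B.comp_fderiv] at hsurj
  exact Function.Surjective.of_comp_left (g := fderiv k (f ∘ φ) z) hsurj B.injective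

theorem measure_image_setOf_iteratedFDeriv_eq_zero {d : ℕ} (hd : (d.factorial : k) ≠ 0)
    (hEF : finrank k E < (d + 1) * finrank k F) {f : E → F} {U : Set E}
    (hf : AnalyticOnNhd k f U) (ν : Measure F) [ν.IsAddHaarMeasure] :
    ν (f '' {x ∈ U | ∀ i, 1 ≤ i → i ≤ d → iteratedFDeriv k i f x = 0}) = 0 := by
  have := FiniteDimensional.complete k F
  exact measure_image_eq_zero_of_isBigO ν hEF fun x hx =>
    isBigO_sub_pow_succ_of_iteratedFDeriv_eq_zero hd (hf x hx.1) hx.2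

end Sard

theorem hasNullCriticalValues_of_finrank_lt {k : Type*} [NontriviallyNormedField k] [ProperSpace k]
    {E F : Type*} [NormedAddCommGroup E] [NormedSpace k E] [FiniteDimensional k E]
    [NormedAddCommGroup F] [NormedSpace k F] [FiniteDimensional k F]
    [MeasurableSpace F] [BorelSpace F] {d : ℕ} (hd : (d.factorial : k) ≠ 0)
    (h : finrank k E < d + finrank k F) : HasNullCriticalValues k E F := by
  intro ν _ f U hU hf
  rcases subsingleton_or_nontrivial F with _ | _
  · have hempty : criticalPoints k f U = ∅ :=
      eq_empty_of_forall_notMem fun x hx => hx.2 (Function.surjective_to_subsingleton _)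
    rw [hempty, image_empty, measure_empty]
  have hF : 0 < finrank k F := Module.finrank_pos
  have hrank : ν (f '' {x ∈ criticalPoints k f U | fderiv k f x ≠ 0}) = 0 := by
    refine measure_image_criticalPoints_fderiv_ne_zero (fun ℓ ℓ' hℓ hℓ' => ?_) hU hf ν
    have hE' := finrank_ker_add_one hℓ
    have hF' := finrank_ker_add_one hℓ'
    exact hasNullCriticalValues_of_finrank_lt hd (by lia)
  have hsucc (i : ℕ) : ν (f '' {x ∈ U | fderiv k f x = 0 ∧ iteratedFDeriv k i f x = 0 ∧
      iteratedFDeriv k (i + 1) f x ≠ 0}) = 0 := by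
    refine measure_image_setOf_iteratedFDeriv_succ_ne_zero i (fun ℓ hℓ => ?_) hU hf ν
    have hE' := finrank_ker_add_one hℓ
    exact hasNullCriticalValues_of_finrank_lt hd (by lia)
  have hflat : ν (f '' {x ∈ U | ∀ i, 1 ≤ i → i ≤ d → iteratedFDeriv k i f x = 0}) = 0 :=
    measure_image_setOf_iteratedFDeriv_eq_zero hd (by nlinarith) hf ν
  refine measure_mono_null (image_mono (criticalPoints_subset_union f U d)) ?_
  rw [image_union, image_union, image_iUnion]
  exact measure_union_null hrank (measure_union_null (measure_iUnion_null hsucc) hflat)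
termination_by finrank k E

section Manifold

variable {k : Type*} [NontriviallyNormedField k]
  {E : Type*} [NormedAddCommGroup E] [NormedSpace k E]
  {F : Type*} [NormedAddCommGroup F] [NormedSpace k F]
  {X : Type*} [TopologicalSpace X] [ChartedSpace E X]
  {Y : Type*} [TopologicalSpace Y] [ChartedSpace F Y]

theorem mdifferentiable_of_mem_maximalAtlas {n : ℕ∞ω} (hn : n ≠ 0)
    {c : OpenPartialHomeomorph X E} (hc : c ∈ IsManifold.maximalAtlas 𝓘(k, E) n X) :
    c.MDifferentiable 𝓘(k, E) 𝓘(k, E) :=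
  ⟨(contMDiffOn_of_mem_maximalAtlas hc).mdifferentiableOn hn,
    (contMDiffOn_symm_of_mem_maximalAtlas hc).mdifferentiableOn hn⟩

theorem surjective_mfderiv_of_surjective_fderiv {f : X → Y} {c : OpenPartialHomeomorph X E}
    {e : OpenPartialHomeomorph Y F} (hc : c.MDifferentiable 𝓘(k, E) 𝓘(k, E))
    (he : e.MDifferentiable 𝓘(k, F) 𝓘(k, F)) {x : X} (hf : ContinuousAt f x) (hx : x ∈ c.source)
    (hfx : f x ∈ e.source) (hg : DifferentiableAt k (e ∘ f ∘ c.symm) (c x))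
    (hsurj : Function.Surjective (fderiv k (e ∘ f ∘ c.symm) (c x))) :
    Function.Surjective (mfderiv 𝓘(k, E) 𝓘(k, F) f x) := by
  have hgx : (e ∘ f ∘ c.symm) (c x) = e (f x) := by simp [c.left_inv hx]
  have hmem : (e ∘ f ∘ c.symm) (c x) ∈ e.target := hgx ▸ e.map_source hfx
  have heq : f =ᶠ[𝓝 x] e.symm ∘ (e ∘ f ∘ c.symm) ∘ c := by
    filter_upwards [c.open_source.mem_nhds hx, hf (e.open_source.mem_nhds hfx)] with y hy hfy
    simp [c.left_inv hy, e.left_inv hfy]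
  have hD := (he.mdifferentiableAt_symm hmem).hasMFDerivAt.comp x
    (hg.hasFDerivAt.hasMFDerivAt.comp x (hc.mdifferentiableAt hx).hasMFDerivAt)
  rw [(hD.congr_of_eventuallyEq heq).mfderiv]
  exact (he.symm.mfderiv_surjective hmem).comp (hsurj.comp (hc.mfderiv_surjective hx))

theorem analyticOnNhd_chart_comp_chart_symm {f : X → Y} (hf : ContMDiff 𝓘(k, E) 𝓘(k, F) ω f)
    {c : OpenPartialHomeomorph X E} (hc : c ∈ IsManifold.maximalAtlas 𝓘(k, E) ω X)
    {e : OpenPartialHomeomorph Y F} (he : e ∈ IsManifold.maximalAtlas 𝓘(k, F) ω Y) :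
    AnalyticOnNhd k (e ∘ f ∘ c.symm) (c.target ∩ c.symm ⁻¹' (f ⁻¹' e.source)) := by
  have hW : IsOpen (c.target ∩ c.symm ⁻¹' (f ⁻¹' e.source)) :=
    c.symm.isOpen_inter_preimage (e.open_source.preimage hf.continuous)
  rw [← hW.analyticOn_iff_analyticOnNhd, ← contDiffOn_omega_iff_analyticOn hW.uniqueDiffOn,
    ← contMDiffOn_iff_contDiffOn]
  exact (contMDiffOn_of_mem_maximalAtlas he).comp (hf.comp_contMDiffOn
    ((contMDiffOn_symm_of_mem_maximalAtlas hc).mono inter_subset_left)) fun z hz => hz.2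

end Manifold

/-- In characteristic `p` one may take `d = p - 1`; in characteristic zero, `d` is arbitrary, and
this is Sard's theorem for analytic manifolds over `ℝ`, `ℂ` and `p`-adic fields. -/
theorem theorem2p5_general {k : Type*} [NontriviallyNormedField k] [LocallyCompactSpace k]
    [MeasurableSpace k] [BorelSpace k] {d m r : ℕ} (hd : (d.factorial : k) ≠ 0) (hmr : m < d + r)
    {X : Type*} [TopologicalSpace X] [SecondCountableTopology X]
    [ChartedSpace (Fin m → k) X] [IsManifold 𝓘(k, Fin m → k) ω X]
    {Y : Type*} [TopologicalSpace Y] [ChartedSpace (Fin r → k) Y]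
    {f : X → Y} (hf : ContMDiff 𝓘(k, Fin m → k) 𝓘(k, Fin r → k) ω f) :
    HasMeasureZero k r (f '' criticalSet k m r f) := by
  have : ProperSpace k := ProperSpace.of_locallyCompactSpace k
  intro e he μ _
  rw [← image_inter_preimage, ← image_comp]
  refine measure_image_null_of_locally_null fun x₀ _ => ?_
  let c := chartAt (Fin m → k) x₀
  have hc : c ∈ IsManifold.maximalAtlas 𝓘(k, Fin m → k) ω X := IsManifold.chart_mem_maximalAtlas x₀
  have hg := analyticOnNhd_chart_comp_chart_symm hf hc he
  have hW := c.symm.isOpen_inter_preimage (e.open_source.preimage hf.continuous)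
  have hnull := hasNullCriticalValues_of_finrank_lt hd (by simpa using hmr) μ ‹_› _ _ hW hg
  refine ⟨c.source, c.open_source.mem_nhds (mem_chart_source _ x₀), measure_mono_null ?_ hnull⟩
  rintro _ ⟨x, ⟨⟨hcrit, hxe⟩, hxc⟩, rfl⟩
  have hxW : c x ∈ c.target ∩ c.symm ⁻¹' (f ⁻¹' e.source) :=
    ⟨c.map_source hxc, by simpa only [mem_preimage, c.left_inv hxc] using hxe⟩
  refine ⟨c x, ⟨hxW, fun hsurj => hcrit ?_⟩, by simp only [Function.comp_apply, c.left_inv hxc]⟩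
  exact surjective_mfderiv_of_surjective_fderiv
    (mdifferentiable_of_mem_maximalAtlas (by simp) hc)
    (mdifferentiable_of_mem_maximalAtlas (by simp) he) hf.continuous.continuousAt hxc hxe
    (hg _ hxW).differentiableAt hsurj

theorem theorem2p5
    {k : Type*} [NontriviallyNormedField k] [LocallyCompactSpace k]
    [MeasurableSpace k] [BorelSpace k]
    {p : ℕ} (hp : 0 < p) [CharP k p]
    {m r : ℕ}
    {X : Type*} [TopologicalSpace X] [SecondCountableTopology X]
    [ChartedSpace (Fin m → k) X] [IsManifold 𝓘(k, Fin m → k) ω X]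
    {Y : Type*} [TopologicalSpace Y] [SecondCountableTopology Y]
    [ChartedSpace (Fin r → k) Y] [IsManifold 𝓘(k, Fin r → k) ω Y]
    (f : X → Y) (hf : ContMDiff 𝓘(k, Fin m → k) 𝓘(k, Fin r → k) ω f)
    (hpmr : (m : ℤ) - (r : ℤ) + 1 < (p : ℤ)) :
    HasMeasureZero k r (f '' criticalSet k m r f) := by
  have : Fact p.Prime := ⟨(CharP.char_is_prime_or_zero k p).resolve_right hp.ne'⟩
  have hd : ((p - 1).factorial : k) ≠ 0 :=
    ((IsUnit.natCast_factorial_iff_of_charP p).2 (Nat.sub_lt hp one_pos)).ne_zero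
  exact theorem2p5_general hd (by lia) hf
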